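/- For an integral domain $R$ with set of nonzero elements $R^\times$, an isometric representation of $R$ on a Hilbert space consists of isometries $S_r$ ($r\in R^\times$) and unitaries $U^n$ ($n\in R$) with $S_rS_t=S_{rt}$, $U^nU^m=U^{m+n}$ and $U^nS_r=S_rU^{rn}$. Let $A(R)$ be the norm closed operator algebra generated by isometries $s_r$ and unitaries $u^n$ that is universal for isometric representations of $R$; if $R$ is a field, then $A(R)$ is a unital $C^*$-algebra. Let $R$ be a field. Then $A(R)$ is not simple, that is, it has a closed two-sided ideal other than $0$ and $A(R)$. More precisely, let $\widehat{(R,+)}$ be the Pontryagin dual of the discrete group $(R,+)$, let $\widehat 0$ be its trivial character, and for $r\in R^\times$ let $\widehat{\alpha_r}(\chi)(n)=\chi(rn)$ and $\alpha_r(f)=f\circ\widehat{\alpha_r}$ for $f\in C(\widehat{(R,+)})$. Then $\widehat{\alpha_r}(\widehat 0)=\widehat 0$ for all $r\in R^\times$, and $I=\{f\in C(\widehat{(R,+)}): f(\widehat 0)=0\}$ is an ideal with $\alpha_r(I)=I$ for all $r\in R^\times$ and $0\neq I\neq C(\widehat{(R,+)})$. There is an isometric unital $*$-homomorphism $\Gamma: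 C(\widehat{(R,+)})\to A(R)$ which maps the function $\chi\mapsto\chi(n)$ to $u^n$ for every $n\in R$, whose range is the $C^*$-subalgebra of $A(R)$ generated by $\{u^n:n\in R\}$, and which satisfies $\Gamma(f)s_r=s_r\Gamma(\alpha_r(f))$ for all $f$ and $r$; and the induced subspace $$J=\overline{\operatorname{span}}\{\Gamma(f)s_r: f\in I,\ r\in R^\times\}$$ is a closed two-sided ideal of $A(R)$ with $0\neq J\neq A(R)$. -/

import Mathlib

open scoped ENNReal nonZeroDivisors

universe u

noncomputable section

namespace IntegralDomainAlgebra

/-- An isometric representation of an integral domain `R` on a Hilbert space `H`: isometries `S r`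
indexed by the nonzero elements `r` of `R` and unitaries `U n` indexed by the elements `n` of `R`,
with `S r S t = S (r t)`, `U n U m = U (m + n)` and `U n S r = S r U (r n)`. -/
structure IsometricRep (R : Type u) [CommRing R] [IsDomain R]
    (H : Type u) [NormedAddCommGroup H] [InnerProductSpace ℂ H] [CompleteSpace H] where
  /-- the isometries -/
  S : R⁰ → (H →L[ℂ] H)
  /-- the unitaries -/
  U : R → (H →L[ℂ] H)
  isometry_S : ∀ r, Isometry (S r)
  unitary_U : ∀ n, U n ∈ unitary (H →L[ℂ] H)
  S_mul : ∀ r t, S r * S t = S (r * t)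
  U_mul : ∀ n m, U n * U m = U (m + n)
  U_mul_S : ∀ (n : R) (r : R⁰), U n * S r = S r * U ((r : R) * n)

/-- A nonzero Hilbert space together with an isometric representation of `R` on it.  Hilbert spaces
are taken in the universe of `R`; this is no restriction, since every isometric representation is
an orthogonal direct sum of representations on Hilbert spaces with a dense subset of cardinality at
most `max |R| ℵ₀`, and such spaces have copies in that universe. -/
structure BundledRep (R : Type u) [CommRing R] [IsDomain R] where
  /-- the Hilbert space -/
  H : Type u
  [normed : NormedAddCommGroup H]
  [inner : InnerProductSpace ℂ H]
  [complete : CompleteSpace H]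
  [nontrivial : Nontrivial H]
  /-- the representation -/
  rep : IsometricRep R H

attribute [instance] BundledRep.normed BundledRep.inner BundledRep.complete BundledRep.nontrivial

section Domain

variable (R : Type u) [CommRing R] [IsDomain R]

/-- The C⋆-algebra of all bounded families of operators, one operator on the space of every
isometric representation of `R` (with the supremum norm and pointwise operations). -/
abbrev Ambient : Type (u + 1) := lp (fun π : BundledRep R => (π.H →L[ℂ] π.H)) ∞

instance : CStarAlgebra (Ambient R) where
  toNormedRing := lp.inftyNormedRing
  toStarRing := lp.inftyStarRing
  toNormedAlgebra := lp.inftyNormedAlgebra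
  norm_mul_self_le := CStarRing.norm_mul_self_le
  toStarModule := inferInstance
  toCompleteSpace := inferInstance

variable {R}

/-- The family of all the `U n`. -/
def ambientU (n : R) : Ambient R :=
  ⟨fun π => π.rep.U n, memℓp_infty ⟨1, by
    rintro _ ⟨π, rfl⟩
    exact (CStarRing.norm_of_mem_unitary (π.rep.unitary_U n)).le⟩⟩

/-- The family of all the `S r`. -/
def ambientS (r : R⁰) : Ambient R :=
  ⟨fun π => π.rep.S r, memℓp_infty ⟨1, by
    rintro _ ⟨π, rfl⟩
    refine ContinuousLinearMap.opNorm_le_bound _ zero_le_one fun x => ?_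
    rw [one_mul]
    exact ((AddMonoidHomClass.isometry_iff_norm _).1 (π.rep.isometry_S r) x).le⟩⟩

variable (R)

/-- The universal operator algebra `A(R)` of an integral domain `R`: the norm closed algebra
generated by the universal unitaries and isometries.  The norm of a polynomial in the generators is
the supremum of the norms of its values over all isometric representations. -/
def universalAlgebra : Subalgebra ℂ (Ambient R) :=
  (Algebra.adjoin ℂ (Set.range (ambientU (R := R)) ∪ Set.range ambientS)).topologicalClosure

end Domain

section RepLemmas

variable {R : Type u} [Field R] {H : Type u} [NormedAddCommGroup H] [InnerProductSpace ℂ H]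
  [CompleteSpace H] (ρ : IsometricRep R H)

/-- The inverse of a nonzero element of a field. -/
def invNZ (r : R⁰) : R⁰ :=
  ⟨(r : R)⁻¹, mem_nonZeroDivisors_of_ne_zero (inv_ne_zero (nonZeroDivisors.ne_zero r.2))⟩

theorem mul_invNZ (r : R⁰) : r * invNZ r = 1 :=
  Subtype.ext (mul_inv_cancel₀ (nonZeroDivisors.ne_zero r.2))

theorem rep_U_zero : ρ.U 0 = 1 := by
  have h := ρ.U_mul 0 0
  rw [add_zero] at h
  have h1 := (ρ.unitary_U 0).1
  calc ρ.U 0 = (star (ρ.U 0) * ρ.U 0) * ρ.U 0 := by rw [h1, one_mul]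
    _ = 1 := by rw [mul_assoc, h, h1]

theorem rep_star_U (n : R) : star (ρ.U n) = ρ.U (-n) := by
  have h : ρ.U n * ρ.U (-n) = 1 := by rw [ρ.U_mul, neg_add_cancel, rep_U_zero]
  calc star (ρ.U n) = star (ρ.U n) * (ρ.U n * ρ.U (-n)) := by rw [h, mul_one]
    _ = ρ.U (-n) := by rw [← mul_assoc, (ρ.unitary_U n).1, one_mul]

theorem rep_star_S_mul (r : R⁰) : star (ρ.S r) * ρ.S r = 1 :=
  (ContinuousLinearMap.norm_map_iff_adjoint_comp_self (ρ.S r)).1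
    ((AddMonoidHomClass.isometry_iff_norm _).1 (ρ.isometry_S r))

theorem rep_S_one : ρ.S 1 = 1 := by
  have h := ρ.S_mul 1 1
  rw [mul_one] at h
  have h1 := rep_star_S_mul ρ 1
  calc ρ.S 1 = (star (ρ.S 1) * ρ.S 1) * ρ.S 1 := by rw [h1, one_mul]
    _ = 1 := by rw [mul_assoc, h, h1]

theorem rep_star_S (r : R⁰) : star (ρ.S r) = ρ.S (invNZ r) := by
  have h : ρ.S r * ρ.S (invNZ r) = 1 := by rw [ρ.S_mul, mul_invNZ, rep_S_one]
  calc star (ρ.S r) = star (ρ.S r) * (ρ.S r * ρ.S (invNZ r)) := by rw [h, mul_one]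
    _ = ρ.S (invNZ r) := by rw [← mul_assoc, rep_star_S_mul, one_mul]

end RepLemmas

section FieldCase

variable (R : Type u) [Field R]

theorem star_mem_universalAlgebra {x : Ambient R} (hx : x ∈ universalAlgebra R) :
    star x ∈ universalAlgebra R := by
  have hgen : star (Set.range (ambientU (R := R)) ∪ Set.range ambientS) ⊆
      Set.range (ambientU (R := R)) ∪ Set.range ambientS := by
    rintro y (⟨n, hn⟩ | ⟨r, hr⟩)
    · refine Or.inl ⟨-n, ?_⟩
      rw [← star_star y, ← hn]
      exact Subtype.ext (funext fun π => (rep_star_U π.rep n).symm)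
    · refine Or.inr ⟨invNZ r, ?_⟩
      rw [← star_star y, ← hr]
      exact Subtype.ext (funext fun π => (rep_star_S π.rep r).symm)
  refine map_mem_closure continuous_star hx fun y hy => ?_
  have h2 : star y ∈ star (Algebra.adjoin ℂ
      (Set.range (ambientU (R := R)) ∪ Set.range ambientS)) := by
    rw [Subalgebra.mem_star_iff, star_star]; exact hy
  rw [Subalgebra.star_adjoin_comm] at h2
  exact Algebra.adjoin_mono hgen h2

/-- For a field `R` the universal operator algebra `A(R)` is closed under adjoints. -/
def universalCStarAlgebra : StarSubalgebra ℂ (Ambient R) where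
  __ := universalAlgebra R
  star_mem' := star_mem_universalAlgebra R

instance : IsClosed (universalCStarAlgebra R : Set (Ambient R)) :=
  Subalgebra.isClosed_topologicalClosure _

/-- The C⋆-algebra `A(R)` of a field `R`. -/
def A : Type (u + 1) := universalCStarAlgebra R

instance : CStarAlgebra (A R) :=
  inferInstanceAs (CStarAlgebra (universalCStarAlgebra R))

variable {R}

/-- The universal unitary `u ^ n` in `A(R)`. -/
def uGen (n : R) : A R :=
  ⟨ambientU n, Subalgebra.le_topologicalClosure _ (Algebra.subset_adjoin (Or.inl ⟨n, rfl⟩))⟩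

/-- The universal isometry `s_r` in `A(R)`. -/
def sGen (r : R⁰) : A R :=
  ⟨ambientS r, Subalgebra.le_topologicalClosure _ (Algebra.subset_adjoin (Or.inr ⟨r, rfl⟩))⟩

end FieldCase

/-- A C⋆-algebra is simple if it is nonzero and its only closed two-sided ideals are zero and the
whole algebra. -/
def IsSimpleCStar (B : Type*) [CStarAlgebra B] : Prop :=
  Nontrivial B ∧ ∀ J : TwoSidedIdeal B, IsClosed (J : Set B) → J = ⊥ ∨ J = ⊤

section Dual

/-- The additive group `(R, +)`, written multiplicatively. -/
def AddGrp (R : Type u) : Type u := Multiplicative R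

variable (R : Type u) [Field R]

instance : CommGroup (AddGrp R) := inferInstanceAs (CommGroup (Multiplicative R))

/-- The group `(R, +)` is discrete. -/
instance : TopologicalSpace (AddGrp R) := ⊥

instance : DiscreteTopology (AddGrp R) := ⟨rfl⟩

/-- The compact Pontryagin dual of the discrete group `(R, +)`. -/
abbrev Dual : Type u := PontryaginDual (AddGrp R)

variable {R}

/-- An element of `R`, seen in `(R, +)`. -/
def toGrp (n : R) : AddGrp R := Multiplicative.ofAdd n

/-- Multiplication by `r` on `(R, +)`. -/
def mulHom (r : R⁰) : AddGrp R →ₜ* AddGrp R where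
  toMonoidHom := AddMonoidHom.toMultiplicative (AddMonoidHom.mulLeft (r : R))
  continuous_toFun := continuous_of_discreteTopology

/-- The map `χ ↦ (n ↦ χ (r n))` on the dual group, induced by multiplication by `r`. -/
def dualMul (r : R⁰) : C(Dual R, Dual R) where
  toFun := PontryaginDual.map (mulHom r)
  continuous_toFun := (PontryaginDual.map (mulHom r)).continuous_toFun

/-- The action of the nonzero elements of `R` on `C(Dual R)`: composition with `dualMul r`. -/
def act (r : R⁰) : C(Dual R, ℂ) →⋆ₐ[ℂ] C(Dual R, ℂ) :=
  ContinuousMap.compStarAlgHom' ℂ ℂ (dualMul r)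

/-- Evaluation of characters at `n ∈ R`, as a continuous function on the dual group. -/
def evalAt (n : R) : C(Dual R, ℂ) where
  toFun χ := (χ (toGrp n) : ℂ)
  continuous_toFun := by
    have h : Continuous fun χ : AddGrp R →ₜ* Circle => χ.toContinuousMap (toGrp n) :=
      (continuous_eval_const (F := C(AddGrp R, Circle)) (toGrp n)).comp
        (ContinuousMonoidHom.isInducing_toContinuousMap (AddGrp R) Circle).continuous
    exact continuous_subtype_val.comp h

variable (R)

/-- The ideal of continuous functions on the dual group that vanish at the trivial character. -/
def idealAtZero : Ideal C(Dual R, ℂ) where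
  carrier := {f | f 1 = 0}
  zero_mem' := rfl
  add_mem' {f g} hf hg := by
    change f 1 + g 1 = 0
    rw [show f 1 = 0 from hf, show g 1 = 0 from hg, add_zero]
  smul_mem' c f hf := by
    change c 1 * f 1 = 0
    rw [show f 1 = 0 from hf, mul_zero]

end Dual

/-- The subspace of `A(R)` induced by an ideal `I` of `C(Dual R)`, where `C(Dual R)` is mapped to
`A(R)` by `Γ`: the closed linear span of the products `Γ f * s_r` with `f ∈ I` and `r ≠ 0`. -/
def induced {R : Type u} [Field R] (Γ : C(Dual R, ℂ) →⋆ₐ[ℂ] A R) (I : Ideal C(Dual R, ℂ)) :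
    Submodule ℂ (A R) :=
  (Submodule.span ℂ {x | ∃ f ∈ I, ∃ r : R⁰, x = Γ f * sGen r}).topologicalClosure

end IntegralDomainAlgebra

end

/-! The trivial character is a fixed point of the action of the nonzero elements of `R` on the dual
group, so the functions vanishing there form an invariant ideal, and it survives in `A R`.

The map `dualEmbedding` comes from Gelfand duality: a character of the commutative C⋆-algebra
generated by the `uGen n` restricts to a character of `(R, +)`, and pulling functions back along
this map and undoing the Gelfand transform sends `evalAt n` to `uGen n`. Its covariance follows on
trigonometric polynomials, hence everywhere by Stone–Weierstrass.

Faithfulness and properness are both read off from one representation, on `ℓ²` of the dual group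
with counting measure. There `dualEmbedding R f` is multiplication by `f`
(`dualEval_dualEmbedding`), so the embedding is injective, hence isometric. Since points carry mass,
the coefficient at the trivial character is defined. It vanishes on the range of every operator in
the induced ideal (`dualEval_coeff_one_eq_zero`) but not on that of the identity. -/

noncomputable section

namespace IntegralDomainAlgebra

/-! ### The representation on `ℓ²` of the discretized dual group -/

section WeightedComposition

variable {X : Type*}

/-- The weighted composition operator `f ↦ w · (f ∘ σ)` on `ℓ²(X)`. -/
def weightedComp (w : X → Circle) (σ : X ≃ X) :
    lp (fun _ : X => ℂ) 2 →ₗᵢ[ℂ] lp (fun _ : X => ℂ) 2 where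
  toFun f := ⟨fun x => w x * f (σ x), memℓp_gen <| by
    have h := (lp.memℓp f).summable (by norm_num)
    refine (h.comp_injective σ.injective).congr fun x => ?_
    rw [norm_mul, Circle.norm_coe, one_mul, Function.comp_apply]⟩
  map_add' f g := lp.ext (funext fun x => mul_add _ _ _)
  map_smul' c f := lp.ext (funext fun x => mul_left_comm _ _ _)
  norm_map' f := by
    have h2 : 0 < (2 : ℝ≥0∞).toReal := by norm_num
    rw [lp.norm_eq_tsum_rpow h2, lp.norm_eq_tsum_rpow h2]
    congr 1
    rw [← σ.tsum_eq fun x => ‖f x‖ ^ (2 : ℝ≥0∞).toReal]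
    refine tsum_congr fun x => ?_
    change ‖(w x : ℂ) * f (σ x)‖ ^ _ = _
    rw [norm_mul, Circle.norm_coe, one_mul]

end WeightedComposition

variable {R : Type u} [Field R]

theorem dualMul_apply (r : R⁰) (χ : Dual R) (n : R) :
    dualMul r χ (toGrp n) = χ (toGrp ((r : R) * n)) := rfl

theorem dual_ext {χ ψ : Dual R} (h : ∀ n : R, χ (toGrp n) = ψ (toGrp n)) : χ = ψ :=
  PontryaginDual.ext h

theorem dualMul_mul (r t : R⁰) (χ : Dual R) : dualMul (r * t) χ = dualMul t (dualMul r χ) :=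
  dual_ext fun n => by
    rw [dualMul_apply, dualMul_apply, dualMul_apply, Submonoid.coe_mul, mul_assoc]

theorem dualMul_one (χ : Dual R) : dualMul 1 χ = χ :=
  dual_ext fun n => by rw [dualMul_apply, Submonoid.coe_one, one_mul]

theorem dualMul_trivial (r : R⁰) : dualMul r (1 : Dual R) = 1 := rfl

theorem invNZ_mul (r : R⁰) : invNZ r * r = 1 := by rw [mul_comm, mul_invNZ]

theorem coe_mul_invNZ (r : R⁰) : (r : R) * (invNZ r : R) = 1 :=
  congrArg Subtype.val (mul_invNZ r)

/-- The bijection `χ ↦ χ ∘ r⁻¹` of the dual group. -/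
def dualPerm (r : R⁰) : Dual R ≃ Dual R where
  toFun := dualMul (invNZ r)
  invFun := dualMul r
  left_inv χ := by rw [← dualMul_mul, invNZ_mul, dualMul_one]
  right_inv χ := by rw [← dualMul_mul, mul_invNZ, dualMul_one]

theorem invNZ_mul_rev (r t : R⁰) : invNZ (r * t) = invNZ r * invNZ t :=
  Subtype.ext (mul_inv _ _)

theorem char_add (χ : Dual R) (m n : R) :
    χ (toGrp (m + n)) = χ (toGrp m) * χ (toGrp n) :=
  map_mul χ (toGrp m) (toGrp n)

theorem char_zero (χ : Dual R) : χ (toGrp 0) = 1 := map_one χ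

variable (R) in
/-- The isometric representation of a field `R` on `ℓ²` of its discretized dual group: `U n`
multiplies by the values of characters at `n`, and `S r` permutes the characters. -/
def dualRep : IsometricRep R (lp (fun _ : Dual R => ℂ) 2) where
  S r := (weightedComp 1 (dualPerm r)).toContinuousLinearMap
  U n := (weightedComp (fun χ => χ (toGrp n)) (Equiv.refl _)).toContinuousLinearMap
  isometry_S r := (weightedComp 1 (dualPerm r)).isometry
  unitary_U n := by
    have hmul (m k : R) (hmk : m + k = 0) :
        (weightedComp (fun χ : Dual R => χ (toGrp m)) (Equiv.refl _)).toContinuousLinearMap *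
          (weightedComp (fun χ : Dual R => χ (toGrp k)) (Equiv.refl _)).toContinuousLinearMap
          = 1 := by
      ext f χ
      change (χ (toGrp m) : ℂ) * (χ (toGrp k) * f χ) = f χ
      rw [← mul_assoc, ← Circle.coe_mul, ← char_add, hmk, char_zero, Circle.coe_one, one_mul]
    -- An invertible isometry is unitary, so the adjoint need not be computed.
    refine IsUnit.mem_unitary_of_star_mul_self
      ⟨⟨_, _, hmul n (-n) (add_neg_cancel n), hmul (-n) n (neg_add_cancel n)⟩, rfl⟩ ?_
    exact (ContinuousLinearMap.norm_map_iff_adjoint_comp_self _).1 fun x =>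
      LinearIsometry.norm_map _ x
  S_mul r t := by
    ext f χ
    change 1 * (1 * f (dualMul (invNZ t) (dualMul (invNZ r) χ))) = 1 * f (dualMul (invNZ (r * t)) χ)
    rw [← dualMul_mul, ← invNZ_mul_rev, one_mul]
  U_mul n m := by
    ext f χ
    change (χ (toGrp n) : ℂ) * (χ (toGrp m) * f χ) = χ (toGrp (m + n)) * f χ
    rw [char_add, Circle.coe_mul]; ring
  U_mul_S n r := by
    ext f χ
    change (χ (toGrp n) : ℂ) * (1 * f (dualMul (invNZ r) χ)) =
      1 * ((dualMul (invNZ r) χ) (toGrp (r * n)) * f (dualMul (invNZ r) χ))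
    rw [dualMul_apply, ← mul_assoc (invNZ r : R), mul_comm (invNZ r : R), coe_mul_invNZ]
    simp

instance : Nontrivial (lp (fun _ : Dual R => ℂ) 2) := by
  classical
  refine ⟨lp.single 2 1 1, 0, fun h => ?_⟩
  simpa using congrArg (fun f : lp (fun _ : Dual R => ℂ) 2 => f 1) h

variable (R) in
/-- The representation `dualRep`, as a bundled representation. -/
def dualBundledRep : BundledRep R where
  H := lp (fun _ : Dual R => ℂ) 2
  rep := dualRep R

/-! ### Relations and density in `A R` -/

/-- The star homomorphism from `A(R)` given by a representation of `R`. -/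
def evalRep (π : BundledRep R) : A R →⋆ₐ[ℂ] (π.H →L[ℂ] π.H) where
  toFun x := x.1 π
  map_one' := rfl
  map_mul' _ _ := rfl
  map_zero' := rfl
  map_add' _ _ := rfl
  commutes' _ := rfl
  map_star' _ := rfl

/-- An element of `A R` is a family of operators indexed by the representations, so the relations of
the generators can be checked in each one. -/
theorem A_ext {x y : A R} (h : ∀ π, evalRep π x = evalRep π y) : x = y :=
  Subtype.ext (lp.ext (funext h))

theorem uGen_mul (m n : R) : uGen m * uGen n = uGen (m + n) :=
  A_ext fun π => (π.rep.U_mul m n).trans (by rw [add_comm]; rfl)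

theorem uGen_zero : uGen (0 : R) = 1 := A_ext fun π => rep_U_zero π.rep

theorem star_uGen (n : R) : star (uGen n) = uGen (-n) := A_ext fun π => rep_star_U π.rep n

theorem sGen_mul (r t : R⁰) : sGen r * sGen t = sGen (r * t) :=
  A_ext fun π => π.rep.S_mul r t

theorem sGen_one : sGen (1 : R⁰) = 1 := A_ext fun π => rep_S_one π.rep

theorem uGen_mul_sGen (n : R) (r : R⁰) : uGen n * sGen r = sGen r * uGen ((r : R) * n) :=
  A_ext fun π => π.rep.U_mul_S n r

/-- Induction on the dense subalgebra of `A(R)` generated by the universal unitaries and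
isometries, followed by taking limits. -/
theorem A_induction {p : A R → Prop} (hclosed : IsClosed {x | p x}) (hu : ∀ n, p (uGen n))
    (hs : ∀ r, p (sGen r)) (halg : ∀ c : ℂ, p (algebraMap ℂ (A R) c))
    (hadd : ∀ x y, p x → p y → p (x + y)) (hmul : ∀ x y, p x → p y → p (x * y)) (x : A R) :
    p x := by
  have hsub : ∀ y (hy : y ∈ Algebra.adjoin ℂ
      (Set.range (ambientU (R := R)) ∪ Set.range ambientS)),
      p ⟨y, Subalgebra.le_topologicalClosure _ hy⟩ := by
    intro y hy
    induction hy using Algebra.adjoin_induction with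
    | mem y hy =>
      obtain ⟨n, rfl⟩ | ⟨r, rfl⟩ := hy
      · exact hu n
      · exact hs r
    | algebraMap c => exact halg c
    | add y z hy hz h1 h2 => exact hadd _ _ h1 h2
    | mul y z hy hz h1 h2 => exact hmul _ _ h1 h2
  have hind : Topology.IsInducing (fun x : A R => (x.1 : Ambient R)) :=
    Topology.IsInducing.subtypeVal
  obtain ⟨C, hC, hCp⟩ := hind.isClosed_iff.1 hclosed
  have hx : x.1 ∈ C := closure_minimal (fun y hy => by
    have h : (⟨y, Subalgebra.le_topologicalClosure _ hy⟩ : A R) ∈ {x | p x} := hsub y hy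
    rwa [← hCp] at h) hC x.2
  have h : x ∈ {x | p x} := by rw [← hCp]; exact hx
  exact h

/-! ### Functions on the dual group and the invariant ideal -/

theorem star_evalAt (n : R) : star (evalAt n) = evalAt (-n) := by
  ext χ
  change (starRingEnd ℂ) (χ (toGrp n) : ℂ) = χ (toGrp (-n))
  rw [← Circle.coe_inv_eq_conj]
  exact congrArg _ (map_inv χ (toGrp n)).symm

theorem act_apply (r : R⁰) (f : C(Dual R, ℂ)) (χ : Dual R) : act r f χ = f (dualMul r χ) := rfl

theorem act_evalAt (r : R⁰) (n : R) : act r (evalAt n) = evalAt ((r : R) * n) := rfl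

theorem act_act_invNZ (r : R⁰) (f : C(Dual R, ℂ)) : act r (act (invNZ r) f) = f := by
  ext χ
  rw [act_apply, act_apply, ← dualMul_mul, mul_invNZ, dualMul_one]

theorem mem_idealAtZero {f : C(Dual R, ℂ)} : f ∈ idealAtZero R ↔ f 1 = 0 := Iff.rfl

theorem act_mem_idealAtZero (r : R⁰) {f : C(Dual R, ℂ)} (hf : f ∈ idealAtZero R) :
    act r f ∈ idealAtZero R := hf

/-- Every member of the ideal is itself an image under `act r`, because `r` is invertible and `act
(invNZ r)` also preserves the ideal. -/
theorem map_act_idealAtZero (r : R⁰) : (idealAtZero R).map (act r) = idealAtZero R := by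
  refine le_antisymm (Ideal.map_le_iff_le_comap.2 fun f hf => hf) fun f hf => ?_
  rw [← act_act_invNZ r f]
  exact Ideal.mem_map_of_mem _ (act_mem_idealAtZero _ hf)

theorem idealAtZero_ne_top : idealAtZero R ≠ ⊤ := fun h => by
  have h1 : (1 : C(Dual R, ℂ)) ∈ idealAtZero R := h ▸ Submodule.mem_top
  exact one_ne_zero (mem_idealAtZero.1 h1)

/-- The inclusion of `ℚ / ℤ` in `ℝ / ℤ`. -/
def ratCircleToReal : AddCircle (1 : ℚ) →+ AddCircle (1 : ℝ) :=
  QuotientAddGroup.map _ _ (Rat.castHom ℝ).toAddMonoidHom (by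
    rw [AddSubgroup.zmultiples_le]
    exact ⟨1, by simp⟩)

theorem ratCircleToReal_injective : Function.Injective ratCircleToReal := by
  rw [injective_iff_map_eq_zero]
  intro a
  induction a using QuotientAddGroup.induction_on with
  | H q =>
    intro h
    obtain ⟨n, hn⟩ := (QuotientAddGroup.eq_zero_iff ((q : ℚ) : ℝ)).1 h
    refine (QuotientAddGroup.eq_zero_iff q).2 ⟨n, ?_⟩
    simp only [zsmul_eq_mul, mul_one] at hn ⊢
    exact_mod_cast hn

/-- Characters with values in `ℚ / ℤ` separate points of any abelian group; the embedding of `ℚ / ℤ`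
in the circle turns them into points of the dual. -/
theorem exists_dual_apply_ne_one {n : R} (hn : n ≠ 0) : ∃ χ : Dual R, χ (toGrp n) ≠ 1 := by
  obtain ⟨c, hc⟩ := CharacterModule.exists_character_apply_ne_zero_of_ne_zero hn
  let χ : AddGrp R →* Circle :=
    { toFun := fun x => AddCircle.toCircle (ratCircleToReal (c (Multiplicative.toAdd x)))
      map_one' := by
        change AddCircle.toCircle (ratCircleToReal (c 0)) = 1
        rw [map_zero, map_zero, AddCircle.toCircle_zero]
      map_mul' := fun x y => by
        change AddCircle.toCircle (ratCircleToReal (c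
          (Multiplicative.toAdd x + Multiplicative.toAdd y))) = _
        rw [map_add, map_add, AddCircle.toCircle_add] }
  refine ⟨(⟨χ, continuous_of_discreteTopology⟩ : AddGrp R →ₜ* Circle), fun h => hc ?_⟩
  change AddCircle.toCircle (ratCircleToReal (c n)) = 1 at h
  rw [← AddCircle.toCircle_zero (T := 1)] at h
  refine ratCircleToReal_injective ?_
  rw [AddCircle.injective_toCircle one_ne_zero h, map_zero]

theorem idealAtZero_ne_bot : idealAtZero R ≠ ⊥ := fun h => by
  obtain ⟨χ, hχ⟩ := exists_dual_apply_ne_one (one_ne_zero (α := R))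
  have h1 : evalAt (1 : R) - 1 ∈ idealAtZero R := by
    rw [mem_idealAtZero]
    exact sub_self (1 : ℂ)
  rw [h, Ideal.mem_bot, sub_eq_zero] at h1
  exact hχ (Circle.ext (DFunLike.congr_fun h1 χ))

variable (R) in
/-- Trigonometric polynomials are dense in the continuous functions on the dual group. -/
theorem adjoin_evalAt_topologicalClosure :
    (StarAlgebra.adjoin ℂ (Set.range (evalAt (R := R)))).topologicalClosure = ⊤ := by
  refine ContinuousMap.starSubalgebra_topologicalClosure_eq_top_of_separatesPoints _ ?_
  intro χ ψ hne
  by_contra! h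
  refine hne (dual_ext fun n => Circle.ext ?_)
  exact h _ ⟨evalAt n, StarAlgebra.subset_adjoin ℂ _ ⟨n, rfl⟩, rfl⟩

/-- A property of continuous functions on the dual group that is closed and stable under algebraic
operations holds for all functions once it holds for the functions `evalAt n`. -/
theorem dual_induction {p : C(Dual R, ℂ) → Prop} (hclosed : IsClosed {f | p f})
    (heval : ∀ n, p (evalAt n)) (halg : ∀ c : ℂ, p (algebraMap ℂ _ c))
    (hadd : ∀ f g, p f → p g → p (f + g)) (hmul : ∀ f g, p f → p g → p (f * g))
    (f : C(Dual R, ℂ)) : p f := by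
  have hf : f ∈ (StarAlgebra.adjoin ℂ (Set.range (evalAt (R := R)))).topologicalClosure := by
    rw [adjoin_evalAt_topologicalClosure]; trivial
  refine closure_minimal (fun g hg => ?_) hclosed hf
  rw [SetLike.mem_coe, ← StarSubalgebra.mem_toSubalgebra, StarAlgebra.adjoin_toSubalgebra] at hg
  change p g
  induction hg using Algebra.adjoin_induction with
  | mem y hy =>
    obtain ⟨n, rfl⟩ | ⟨n, hn⟩ := hy
    · exact heval n
    · rw [← star_star y, ← hn, star_evalAt]
      exact heval _
  | algebraMap c => exact halg c
  | add y z hy hz h1 h2 => exact hadd _ _ h1 h2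
  | mul y z hy hz h1 h2 => exact hmul _ _ h1 h2

/-! ### Gelfand duality for the algebra of the unitaries -/

variable (R) in
/-- The C⋆-subalgebra of `A(R)` generated by the universal unitaries. -/
abbrev unitarySubalgebra : StarSubalgebra ℂ (A R) :=
  (StarAlgebra.adjoin ℂ (Set.range (uGen (R := R)))).topologicalClosure

instance : IsClosed (unitarySubalgebra R : Set (A R)) :=
  StarSubalgebra.isClosed_topologicalClosure _

theorem uGen_comm (m n : R) : uGen m * uGen n = uGen n * uGen m := by
  rw [uGen_mul, uGen_mul, add_comm]

theorem unitarySubalgebra_mul_comm (x y : unitarySubalgebra R) : x * y = y * x := by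
  have h := StarAlgebra.isMulCommutative_adjoin ℂ (A := A R) (s := Set.range (uGen (R := R)))
    (by rintro _ ⟨m, rfl⟩ _ ⟨n, rfl⟩; exact uGen_comm m n)
    (by rintro _ ⟨m, rfl⟩ _ ⟨n, rfl⟩; rw [star_uGen]; exact uGen_comm m _)
  exact (StarSubalgebra.commRingTopologicalClosure
    (StarAlgebra.adjoin ℂ (Set.range (uGen (R := R)))) h.is_comm.comm).mul_comm x y

instance : CommCStarAlgebra (unitarySubalgebra R) where
  __ := (inferInstance : CStarAlgebra (unitarySubalgebra R))
  mul_comm := unitarySubalgebra_mul_comm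

/-- The universal unitary, as an element of the C⋆-algebra generated by such. -/
def uSub (n : R) : unitarySubalgebra R :=
  ⟨uGen n, subset_closure (StarAlgebra.subset_adjoin ℂ _ ⟨n, rfl⟩)⟩

theorem uSub_add (m n : R) : uSub (m + n) = uSub m * uSub n :=
  Subtype.ext (uGen_mul m n).symm

theorem uSub_zero : uSub (0 : R) = 1 := Subtype.ext uGen_zero

theorem star_uSub (n : R) : star (uSub n) = uSub (-n) := Subtype.ext (star_uGen n)

open WeakDual

theorem norm_apply_uSub (φ : characterSpace ℂ (unitarySubalgebra R)) (n : R) :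
    ‖φ (uSub n)‖ = 1 := by
  have h : star (φ (uSub n)) * φ (uSub n) = 1 := by
    rw [← map_star, star_uSub, ← map_mul, ← uSub_add, neg_add_cancel, uSub_zero, map_one]
  have h2 : ‖φ (uSub n)‖ * ‖φ (uSub n)‖ = 1 := by
    rw [← CStarRing.norm_star_mul_self, h, norm_one]
  nlinarith [norm_nonneg (φ (uSub n))]

/-- The character of `(R, +)` defined by a character of the C⋆-algebra of the unitaries. -/
def charOfCharacterSpace (φ : characterSpace ℂ (unitarySubalgebra R)) : Dual R :=
  (⟨{ toFun := fun x => ⟨φ (uSub (Multiplicative.toAdd x)),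
        mem_sphere_zero_iff_norm.2 (norm_apply_uSub φ _)⟩
      map_one' := Circle.ext (by
        change φ (uSub 0) = 1
        rw [uSub_zero, map_one])
      map_mul' := fun x y => Circle.ext (by
        change φ (uSub (Multiplicative.toAdd x + Multiplicative.toAdd y)) = _
        rw [uSub_add, map_mul]; rfl) }, continuous_of_discreteTopology⟩ : AddGrp R →ₜ* Circle)

/-- As `(R, +)` is discrete, joint continuity reduces to continuity of evaluation at each fixed
element, which is the weak-⋆ topology. -/
theorem continuous_charOfCharacterSpace :
    Continuous (charOfCharacterSpace : characterSpace ℂ (unitarySubalgebra R) → Dual R) := by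
  refine ContinuousMonoidHom.continuous_of_continuous_uncurry _ ?_
  refine continuous_prod_of_discrete_right.2 fun x => ?_
  refine Continuous.subtype_mk (f := fun φ : characterSpace ℂ (unitarySubalgebra R) =>
    φ (uSub (Multiplicative.toAdd x))) ?_ _
  exact (WeakDual.eval_continuous _).comp continuous_subtype_val

variable (R) in
/-- The map from characters of the C⋆-algebra of the unitaries to characters of `(R, +)`. -/
def charMap : C(characterSpace ℂ (unitarySubalgebra R), Dual R) :=
  ⟨charOfCharacterSpace, continuous_charOfCharacterSpace⟩

variable (R) in
/-- The embedding of `C(Dual R)` in `A(R)` that maps `evalAt n` to `uGen n`. -/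
def dualEmbedding : C(Dual R, ℂ) →⋆ₐ[ℂ] A R :=
  (unitarySubalgebra R).subtype.comp <|
    ((gelfandStarTransform (unitarySubalgebra R)).symm : _ →⋆ₐ[ℂ] unitarySubalgebra R).comp <|
      ContinuousMap.compStarAlgHom' ℂ ℂ (charMap R)

theorem dualEmbedding_evalAt (n : R) : dualEmbedding R (evalAt n) = uGen n := by
  have h : ContinuousMap.compStarAlgHom' ℂ ℂ (charMap R) (evalAt n) =
      gelfandStarTransform (unitarySubalgebra R) (uSub n) := by
    ext φ; rfl
  change (((gelfandStarTransform (unitarySubalgebra R)).symm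
    (ContinuousMap.compStarAlgHom' ℂ ℂ (charMap R) (evalAt n)) : unitarySubalgebra R) : A R) = _
  rw [h, StarAlgEquiv.symm_apply_apply]; rfl

theorem continuous_starAlgHom {B C : Type*} [CStarAlgebra B] [CStarAlgebra C] (φ : B →⋆ₐ[ℂ] C) :
    Continuous φ :=
  AddMonoidHomClass.continuous_of_bound φ 1 fun x => by
    rw [one_mul]
    exact NonUnitalStarAlgHom.norm_apply_le φ x

theorem continuous_dualEmbedding : Continuous (dualEmbedding R) :=
  continuous_starAlgHom _

theorem continuous_evalRep (π : BundledRep R) : Continuous (evalRep π) :=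
  continuous_starAlgHom _

/-! ### Faithfulness of the embedding -/

variable (R) in
/-- The star homomorphism from `A(R)` given by the representation on `ℓ²(Dual R)`. -/
def dualEval : A R →⋆ₐ[ℂ] (lp (fun _ : Dual R => ℂ) 2 →L[ℂ] lp (fun _ : Dual R => ℂ) 2) :=
  evalRep (dualBundledRep R)

/-- The coefficients of vectors in the image of an operator depend continuously on the operator. -/
theorem continuous_dualEval_coeff (ξ : lp (fun _ : Dual R => ℂ) 2) (χ : Dual R) :
    Continuous fun x : A R => dualEval R x ξ χ := by
  have h1 : Continuous fun x : A R => dualEval R x ξ :=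
    (continuous_evalRep (dualBundledRep R)).clm_apply continuous_const
  exact (lp.evalCLM ℂ (fun _ : Dual R => ℂ) 2 χ).continuous.comp h1

theorem dualEval_dualEmbedding (f : C(Dual R, ℂ)) (ξ : lp (fun _ : Dual R => ℂ) 2) (χ : Dual R) :
    dualEval R (dualEmbedding R f) ξ χ = f χ * ξ χ := by
  -- The vector is quantified inside the induction: for a product `f * g`, the hypothesis on `f` is
  -- used at the image of `ξ` under `g`.
  refine dual_induction (p := fun f => ∀ ξ : lp (fun _ : Dual R => ℂ) 2,
    dualEval R (dualEmbedding R f) ξ χ = f χ * ξ χ) ?_ ?_ ?_ ?_ ?_ f ξ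
  · simp only [Set.ofPred_forall]
    exact isClosed_iInter fun ξ => isClosed_eq
      ((continuous_dualEval_coeff ξ χ).comp continuous_dualEmbedding)
      ((continuous_eval_const χ).mul continuous_const)
  · intro n ξ
    rw [dualEmbedding_evalAt]; rfl
  · intro c ξ
    rw [AlgHomClass.commutes, AlgHomClass.commutes]; rfl
  · intro f g hf hg ξ
    rw [map_add, map_add, ContinuousMap.add_apply, add_mul, ← hf, ← hg]; rfl
  · intro f g hf hg ξ
    rw [map_mul, map_mul, ContinuousMap.mul_apply, mul_assoc, ← hg, ← hf]; rfl

theorem exists_coeff_ne_zero (χ : Dual R) : ∃ ξ : lp (fun _ : Dual R => ℂ) 2, ξ χ = 1 := by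
  classical
  exact ⟨lp.single 2 χ 1, lp.single_apply_self 2 χ 1⟩

theorem dualEmbedding_injective : Function.Injective (dualEmbedding R) := by
  rw [injective_iff_map_eq_zero]
  intro f hf
  ext χ
  obtain ⟨ξ, hξ⟩ := exists_coeff_ne_zero χ
  have h := dualEval_dualEmbedding f ξ χ
  rw [hf, map_zero, hξ, mul_one] at h
  exact h.symm

theorem isometry_dualEmbedding : Isometry (dualEmbedding R) :=
  NonUnitalStarAlgHom.isometry (dualEmbedding R) dualEmbedding_injective

/-- The range of an isometry from a complete space is closed, so containing the generators suffices
for the nontrivial inclusion. -/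
theorem range_dualEmbedding : (dualEmbedding R).range = unitarySubalgebra R := by
  refine le_antisymm ?_ (StarSubalgebra.topologicalClosure_minimal
    (StarAlgebra.adjoin_le ?_) ?_)
  · rintro _ ⟨f, rfl⟩
    exact Subtype.property _
  · rintro _ ⟨n, rfl⟩
    exact ⟨evalAt n, dualEmbedding_evalAt n⟩
  · exact isometry_dualEmbedding.isClosedEmbedding.isClosed_range

/-! ### Covariance and the induced ideal -/

theorem dualEmbedding_mul_sGen (f : C(Dual R, ℂ)) (r : R⁰) :
    dualEmbedding R f * sGen r = sGen r * dualEmbedding R (act r f) := by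
  induction f using dual_induction with
  | hclosed =>
    refine isClosed_eq (continuous_dualEmbedding.mul continuous_const)
      (continuous_const.mul (continuous_dualEmbedding.comp (continuous_starAlgHom (act r))))
  | heval n => rw [act_evalAt, dualEmbedding_evalAt, dualEmbedding_evalAt, uGen_mul_sGen]
  | halg c => rw [AlgHomClass.commutes, AlgHomClass.commutes, AlgHomClass.commutes,
      Algebra.commutes]
  | hadd f g hf hg => rw [map_add, map_add, map_add, add_mul, mul_add, hf, hg]
  | hmul f g hf hg =>
    rw [map_mul, map_mul, map_mul, mul_assoc, hg, ← mul_assoc, hf, mul_assoc]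

theorem sGen_mul_dualEmbedding (f : C(Dual R, ℂ)) (r : R⁰) :
    sGen r * dualEmbedding R f = dualEmbedding R (act (invNZ r) f) * sGen r := by
  rw [dualEmbedding_mul_sGen, act_act_invNZ]

theorem sGen_mul_uGen (n : R) (r : R⁰) :
    sGen r * uGen n = uGen ((invNZ r : R) * n) * sGen r := by
  rw [uGen_mul_sGen, ← mul_assoc, coe_mul_invNZ, one_mul]

variable (R) in
/-- The subspace of `A(R)` induced by the ideal of functions vanishing at the trivial character. -/
abbrev inducedAtZero : Submodule ℂ (A R) := induced (dualEmbedding R) (idealAtZero R)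

theorem dualEmbedding_mul_sGen_mem {f : C(Dual R, ℂ)} (hf : f ∈ idealAtZero R) (r : R⁰) :
    dualEmbedding R f * sGen r ∈ inducedAtZero R :=
  Submodule.le_topologicalClosure _ (Submodule.subset_span ⟨f, hf, r, rfl⟩)

/-- A closed property that is stable under linear combinations holds on the induced subspace if it
holds on the generators. -/
theorem inducedAtZero_induction {N : Submodule ℂ (A R)} (hN : IsClosed (N : Set (A R)))
    (h : ∀ f ∈ idealAtZero R, ∀ r, dualEmbedding R f * sGen r ∈ N) : inducedAtZero R ≤ N :=
  Submodule.topologicalClosure_minimal _ (Submodule.span_le.2 (by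
    rintro _ ⟨f, hf, r, rfl⟩
    exact h f hf r)) hN

theorem isClosed_inducedAtZero : IsClosed (inducedAtZero R : Set (A R)) :=
  Submodule.isClosed_topologicalClosure _

/-- A unitary on the left is absorbed because `idealAtZero R` is an ideal; an isometry passes
through `dualEmbedding R f` because that ideal is invariant. -/
theorem mul_mem_inducedAtZero_left (x : A R) {y : A R} (hy : y ∈ inducedAtZero R) :
    x * y ∈ inducedAtZero R := by
  have hcl (x : A R) : IsClosed
      (((inducedAtZero R).comap (LinearMap.mulLeft ℂ x) : Submodule ℂ (A R)) : Set (A R)) :=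
    isClosed_inducedAtZero.preimage (continuous_const_mul x)
  refine A_induction (p := fun x => ∀ y ∈ inducedAtZero R, x * y ∈ inducedAtZero R)
    ?_ ?_ ?_ ?_ ?_ ?_ x y hy
  · simp only [Set.ofPred_forall]
    exact isClosed_biInter fun y _ => isClosed_inducedAtZero.preimage (continuous_mul_const y)
  · intro n y hy

    refine inducedAtZero_induction (hcl _) (fun f hf r => ?_) hy
    change uGen n * (dualEmbedding R f * sGen r) ∈ inducedAtZero R
    rw [← mul_assoc, ← dualEmbedding_evalAt, ← map_mul]
    exact dualEmbedding_mul_sGen_mem (Ideal.mul_mem_left _ _ hf) r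
  · intro t y hy

    refine inducedAtZero_induction (hcl _) (fun f hf r => ?_) hy
    change sGen t * (dualEmbedding R f * sGen r) ∈ inducedAtZero R
    rw [← mul_assoc, sGen_mul_dualEmbedding, mul_assoc, sGen_mul]
    exact dualEmbedding_mul_sGen_mem (act_mem_idealAtZero _ hf) _
  · intro c y hy
    rw [← Algebra.smul_def]; exact Submodule.smul_mem _ _ hy
  · intro x z hx hz y hy
    rw [add_mul]; exact Submodule.add_mem _ (hx y hy) (hz y hy)
  · intro x z hx hz y hy
    rw [mul_assoc]; exact hx _ (hz y hy)

/-- An isometry on the right merges with `sGen r`; a unitary moves left past `sGen r`, its exponent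
divided by `r`, and is then absorbed by the ideal. -/
theorem mul_mem_inducedAtZero_right (x : A R) {y : A R} (hy : y ∈ inducedAtZero R) :
    y * x ∈ inducedAtZero R := by
  have hcl (x : A R) : IsClosed
      (((inducedAtZero R).comap (LinearMap.mulRight ℂ x) : Submodule ℂ (A R)) : Set (A R)) :=
    isClosed_inducedAtZero.preimage (continuous_mul_const x)
  refine A_induction (p := fun x => ∀ y ∈ inducedAtZero R, y * x ∈ inducedAtZero R)
    ?_ ?_ ?_ ?_ ?_ ?_ x y hy
  · simp only [Set.ofPred_forall]
    exact isClosed_biInter fun y _ => isClosed_inducedAtZero.preimage (continuous_const_mul y)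
  · intro n y hy

    refine inducedAtZero_induction (hcl _) (fun f hf r => ?_) hy
    change dualEmbedding R f * sGen r * uGen n ∈ inducedAtZero R
    rw [mul_assoc, sGen_mul_uGen, ← mul_assoc, ← dualEmbedding_evalAt, ← map_mul]
    exact dualEmbedding_mul_sGen_mem (Ideal.mul_mem_right _ _ hf) r
  · intro t y hy

    refine inducedAtZero_induction (hcl _) (fun f hf r => ?_) hy
    change dualEmbedding R f * sGen r * sGen t ∈ inducedAtZero R
    rw [mul_assoc, sGen_mul]
    exact dualEmbedding_mul_sGen_mem hf _
  · intro c y hy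

    rw [← Algebra.commutes, ← Algebra.smul_def]; exact Submodule.smul_mem _ _ hy
  · intro x z hx hz y hy
    rw [mul_add]; exact Submodule.add_mem _ (hx y hy) (hz y hy)
  · intro x z hx hz y hy
    rw [← mul_assoc]; exact hz _ (hx y hy)

/-- In the representation on `ℓ²(Dual R)`, operators in the induced subspace map to vectors with
vanishing coefficient at the trivial character. -/
theorem dualEval_coeff_one_eq_zero {x : A R} (hx : x ∈ inducedAtZero R)
    (ξ : lp (fun _ : Dual R => ℂ) 2) : dualEval R x ξ 1 = 0 := by
  let N : Submodule ℂ (A R) :=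
    { carrier := {x | dualEval R x ξ 1 = 0}
      zero_mem' := by
        change dualEval R 0 ξ 1 = 0
        rw [map_zero]; rfl
      add_mem' := fun {x y} hx hy => by
        change dualEval R (x + y) ξ 1 = 0
        rw [map_add]
        change dualEval R x ξ 1 + dualEval R y ξ 1 = 0
        rw [show dualEval R x ξ 1 = 0 from hx, show dualEval R y ξ 1 = 0 from hy, add_zero]
      smul_mem' := fun c x hx => by
        change dualEval R (c • x) ξ 1 = 0
        rw [map_smul]
        change c * dualEval R x ξ 1 = 0
        rw [show dualEval R x ξ 1 = 0 from hx, mul_zero] }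
  have hN : IsClosed (N : Set (A R)) :=
    isClosed_eq (continuous_dualEval_coeff ξ 1) continuous_const
  refine inducedAtZero_induction hN (fun f hf r => ?_) hx
  change dualEval R (dualEmbedding R f * sGen r) ξ 1 = 0
  rw [map_mul]
  change dualEval R (dualEmbedding R f) (dualEval R (sGen r) ξ) 1 = 0
  -- Whatever vector `sGen r` produces, its coefficient at the trivial character is multiplied by `f
  -- 1 = 0`.
  rw [dualEval_dualEmbedding, mem_idealAtZero.1 hf, zero_mul]

variable (R) in
/-- The closed two-sided ideal of `A(R)` induced by the functions vanishing at the trivial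
character. -/
def twoSidedIdealAtZero : TwoSidedIdeal (A R) :=
  TwoSidedIdeal.mk' (inducedAtZero R) (Submodule.zero_mem _) (Submodule.add_mem _)
    (Submodule.neg_mem _) (mul_mem_inducedAtZero_left _) (mul_mem_inducedAtZero_right _)

theorem mem_twoSidedIdealAtZero {x : A R} : x ∈ twoSidedIdealAtZero R ↔ x ∈ inducedAtZero R :=
  TwoSidedIdeal.mem_mk' _ _ _ _ _ _ _

theorem coe_twoSidedIdealAtZero :
    (twoSidedIdealAtZero R : Set (A R)) = inducedAtZero R :=
  Set.ext fun _ => mem_twoSidedIdealAtZero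

theorem twoSidedIdealAtZero_ne_bot : twoSidedIdealAtZero R ≠ ⊥ := fun h => by
  obtain ⟨f, hf, hf0⟩ := Submodule.exists_mem_ne_zero_of_ne_bot (idealAtZero_ne_bot (R := R))
  -- Since `sGen 1 = 1`, the induced ideal contains the image of `idealAtZero R` itself.
  have h1 := dualEmbedding_mul_sGen_mem hf 1
  rw [sGen_one, mul_one, ← mem_twoSidedIdealAtZero, h, TwoSidedIdeal.mem_bot] at h1
  exact hf0 (dualEmbedding_injective (h1.trans (map_zero _).symm))

theorem twoSidedIdealAtZero_ne_top : twoSidedIdealAtZero R ≠ ⊤ := fun h => by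
  have h1 : (1 : A R) ∈ twoSidedIdealAtZero R := h ▸ trivial
  obtain ⟨ξ, hξ⟩ := exists_coeff_ne_zero (1 : Dual R)
  have h2 := dualEval_coeff_one_eq_zero (mem_twoSidedIdealAtZero.1 h1) ξ
  rw [map_one] at h2
  exact one_ne_zero (hξ.symm.trans h2)

theorem isClosed_twoSidedIdealAtZero : IsClosed (twoSidedIdealAtZero R : Set (A R)) := by
  rw [coe_twoSidedIdealAtZero]
  exact isClosed_inducedAtZero

end IntegralDomainAlgebra

end

theorem proposition5 (R : Type u) [Field R] :
    -- the C⋆-algebra `A(R)` is not simple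
    ¬ IntegralDomainAlgebra.IsSimpleCStar (IntegralDomainAlgebra.A R) ∧
    -- the trivial character is fixed by the action on the dual group
    (∀ r : nonZeroDivisors R, IntegralDomainAlgebra.dualMul r 1 = 1) ∧
    -- the functions vanishing there are a nontrivial invariant ideal
    (∀ r : nonZeroDivisors R,
      (IntegralDomainAlgebra.idealAtZero R).map (IntegralDomainAlgebra.act r) =
        IntegralDomainAlgebra.idealAtZero R) ∧
    IntegralDomainAlgebra.idealAtZero R ≠ ⊥ ∧
    IntegralDomainAlgebra.idealAtZero R ≠ ⊤ ∧
    -- `C(Dual R)` is the C⋆-subalgebra of `A(R)` generated by the `u ^ n`, in a covariant way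
    ∃ Γ : C(IntegralDomainAlgebra.Dual R, ℂ) →⋆ₐ[ℂ] IntegralDomainAlgebra.A R,
      Isometry Γ ∧
      (∀ n : R, Γ (IntegralDomainAlgebra.evalAt n) = IntegralDomainAlgebra.uGen n) ∧
      Γ.range = (StarAlgebra.adjoin ℂ
        (Set.range (IntegralDomainAlgebra.uGen (R := R)))).topologicalClosure ∧
      (∀ (f : C(IntegralDomainAlgebra.Dual R, ℂ)) (r : nonZeroDivisors R),
        Γ f * IntegralDomainAlgebra.sGen r =
          IntegralDomainAlgebra.sGen r * Γ (IntegralDomainAlgebra.act r f)) ∧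
      -- the induced subspace is a nontrivial closed two-sided ideal of `A(R)`
      ∃ J : TwoSidedIdeal (IntegralDomainAlgebra.A R),
        (J : Set (IntegralDomainAlgebra.A R)) =
          IntegralDomainAlgebra.induced Γ (IntegralDomainAlgebra.idealAtZero R) ∧
        IsClosed (J : Set (IntegralDomainAlgebra.A R)) ∧ J ≠ ⊥ ∧ J ≠ ⊤ := by
  refine ⟨fun h => (h.2 _ IntegralDomainAlgebra.isClosed_twoSidedIdealAtZero).elim
      IntegralDomainAlgebra.twoSidedIdealAtZero_ne_bot
      IntegralDomainAlgebra.twoSidedIdealAtZero_ne_top,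
    IntegralDomainAlgebra.dualMul_trivial, IntegralDomainAlgebra.map_act_idealAtZero,
    IntegralDomainAlgebra.idealAtZero_ne_bot, IntegralDomainAlgebra.idealAtZero_ne_top,
    IntegralDomainAlgebra.dualEmbedding R, IntegralDomainAlgebra.isometry_dualEmbedding,
    IntegralDomainAlgebra.dualEmbedding_evalAt, IntegralDomainAlgebra.range_dualEmbedding,
    IntegralDomainAlgebra.dualEmbedding_mul_sGen,
    IntegralDomainAlgebra.twoSidedIdealAtZero R, IntegralDomainAlgebra.coe_twoSidedIdealAtZero,
    IntegralDomainAlgebra.isClosed_twoSidedIdealAtZero,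
    IntegralDomainAlgebra.twoSidedIdealAtZero_ne_bot,
    IntegralDomainAlgebra.twoSidedIdealAtZero_ne_top⟩
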